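/- Consider the system $x[t+1]=Ax[t]+Bu[t]+w[t]$, $t\ge 0$, with $A\in\mathbb{R}^{n\times n}$, $B\in\mathbb{R}^{n\times m}$, state $x[t]\in\mathbb{R}^n$, input $u[t]\in\mathbb{R}^m$, and i.i.d. Gaussian noise $w[t]\sim N(0,W)$, where $W$ is positive semidefinite. The initial state and the inputs are non-anticipative: there is a filtration $(\mathcal{F}_t)_{t\ge 0}$ such that $x[0]$ is $\mathcal{F}_0$-measurable, $u[t]$ is $\mathcal{F}_t$-measurable, and $w[t]$ is $\mathcal{F}_{t+1}$-measurable and independent of $\mathcal{F}_t$. Assume $W\preceq rI$ and $\|[A\;\,B]\|_F\le s$ with $r,s>0$, and let $\lambda>0$ and $\delta\in(0,1]$. Let $\theta_i\in\mathbb{R}^{n+m}$ be the transposed $i$-th row of $[A\;\,B]$, let $Z[k]$ be the matrix with rows $(x[t]^\top,u[t]^\top)$, $t=0,\dots,k-1$, let $X_i[k]=(x_i[1],\dots,x_i[k])^\top$, let $V[k]=Z[k]^\top Z[k]+\lambda I$, and let $$\hat\theta_i[k]=V[k]^{-1}Z[k]^\top X_i[k]$$ be the regularized least-squares estimate, i.e.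 the unique minimizer of $\|X_i[k]-Z[k]\bar\theta\|_2^2+\lambda\|\bar\theta\|_2^2$ over $\bar\theta\in\mathbb{R}^{n+m}$. Then for every $k\ge 0$ $$\mathbb{P}\Big\{\big\|V[k]^{1/2}(\hat\theta_i[k]-\theta_i)\big\|_2\le\beta_k(\delta/n)\ \text{ for all } i=1,\dots,n\Big\}\ \ge\ 1-\delta ,$$ where $$\beta_k(\delta):=\sqrt{r}\,\sqrt{2\log\!\Big(\frac{\det(V[k])^{1/2}}{\lambda^{(n+m)/2}\,\delta}\Big)}+\lambda^{1/2}s .$$ -/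

import Mathlib

open MeasureTheory ProbabilityTheory Matrix
open scoped MatrixOrder

/-- The Frobenius norm of a real matrix. -/
noncomputable def frobNorm {p q : Type*} [Fintype p] [Fintype q] (M : Matrix p q ℝ) : ℝ :=
  letI := Matrix.frobeniusNormedAddCommGroup (m := p) (n := q) (α := ℝ)
  ‖M‖

/-- The parameter vector `θᵢ`: the `i`-th row of `[A B]`, as a vector of the Euclidean
space `ℝⁿ⁺ᵐ`. -/
noncomputable def trueParam {n m : ℕ} (A : Matrix (Fin n) (Fin n) ℝ)
    (B : Matrix (Fin n) (Fin m) ℝ) (i : Fin n) : EuclideanSpace ℝ (Fin n ⊕ Fin m) :=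
  WithLp.toLp 2 (Matrix.fromCols A B i)

/-- The data matrix `Z[k]` of a sample path: its rows are `(x[t]ᵀ, u[t]ᵀ)`, `t = 0, …, k - 1`. -/
def dataMatrix {n m : ℕ} (x : ℕ → EuclideanSpace ℝ (Fin n)) (u : ℕ → EuclideanSpace ℝ (Fin m))
    (k : ℕ) : Matrix (Fin k) (Fin n ⊕ Fin m) ℝ :=
  Matrix.of fun t => Sum.elim (fun i => x t i) (fun j => u t j)

/-- The response vector `Xᵢ[k] = (xᵢ[1], …, xᵢ[k])`. -/
def responseVec {n : ℕ} (x : ℕ → EuclideanSpace ℝ (Fin n)) (k : ℕ) (i : Fin n) : Fin k → ℝ :=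
  fun t => x (t + 1) i

/-- The regularized Gram matrix `ZᵀZ + lam • I`. -/
def regGram {κ ι : Type*} [Fintype κ] [DecidableEq ι]
    (lam : ℝ) (Z : Matrix κ ι ℝ) : Matrix ι ι ℝ :=
  Zᵀ * Z + lam • (1 : Matrix ι ι ℝ)

/-- The regularized least-squares objective `‖X - Z θ‖₂² + lam * ‖θ‖₂²`. -/
noncomputable def ridgeObjective {κ ι : Type*} [Fintype κ] [Fintype ι]
    (lam : ℝ) (Z : Matrix κ ι ℝ) (X : κ → ℝ) (θ : EuclideanSpace ℝ ι) : ℝ :=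
  ‖(WithLp.toLp 2 (X - Z *ᵥ θ.ofLp) : EuclideanSpace ℝ κ)‖ ^ 2 + lam * ‖θ‖ ^ 2

/-- The regularized least-squares estimate `(ZᵀZ + lam • I)⁻¹ Zᵀ X`. -/
noncomputable def ridgeEstimate {κ ι : Type*} [Fintype κ] [Fintype ι] [DecidableEq ι]
    (lam : ℝ) (Z : Matrix κ ι ℝ) (X : κ → ℝ) : EuclideanSpace ℝ ι :=
  WithLp.toLp 2 ((regGram lam Z)⁻¹ *ᵥ (Zᵀ *ᵥ X))

/-- The Gram matrix is positive definite for `lam > 0`, so that its inverse and its square root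
are the genuine ones. -/
theorem regGram_posDef {κ ι : Type*} [Fintype κ] [Fintype ι] [DecidableEq ι]
    {lam : ℝ} (hlam : 0 < lam) (Z : Matrix κ ι ℝ) : (regGram lam Z).PosDef := by
  have h1 : (Zᵀ * Z).PosSemidef := by
    simpa [Matrix.conjTranspose_eq_transpose_of_trivial] using
      Matrix.posSemidef_conjTranspose_mul_self Z
  exact Matrix.PosDef.posSemidef_add h1 (Matrix.PosDef.one.smul hlam)

/-- The estimate is the unique minimizer of the regularized least-squares objective. -/
theorem ridgeEstimate_unique_min {κ ι : Type*} [Fintype κ] [Fintype ι] [DecidableEq ι]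
    {lam : ℝ} (hlam : 0 < lam) (Z : Matrix κ ι ℝ) (X : κ → ℝ) (θ : EuclideanSpace ℝ ι) :
    (∀ η, ridgeObjective lam Z X θ ≤ ridgeObjective lam Z X η) ↔
      θ = ridgeEstimate lam Z X := by
  set θ₀ := ridgeEstimate lam Z X with hθ₀
  have hdet : IsUnit (regGram lam Z).det := (regGram_posDef hlam Z).det_pos.ne'.isUnit
  have hnormal : Zᵀ *ᵥ (Z *ᵥ θ₀.ofLp) + lam • θ₀.ofLp = Zᵀ *ᵥ X := by
    have h : regGram lam Z *ᵥ θ₀.ofLp = Zᵀ *ᵥ X := by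
      simp [hθ₀, ridgeEstimate, Matrix.mulVec_mulVec, Matrix.mul_nonsing_inv_cancel_left _ _ hdet]
    rw [← h, regGram, Matrix.add_mulVec, Matrix.smul_mulVec, Matrix.one_mulVec,
      Matrix.mulVec_mulVec]
  have hsq : ∀ v : EuclideanSpace ℝ ι, ‖v‖ ^ 2 = v.ofLp ⬝ᵥ v.ofLp := fun v => by
    rw [EuclideanSpace.real_norm_sq_eq]
    simp [dotProduct, sq]
  have hsq' : ∀ v : EuclideanSpace ℝ κ, ‖v‖ ^ 2 = v.ofLp ⬝ᵥ v.ofLp := fun v => by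
    rw [EuclideanSpace.real_norm_sq_eq]
    simp [dotProduct, sq]
  have key : ∀ η : EuclideanSpace ℝ ι, ridgeObjective lam Z X η = ridgeObjective lam Z X θ₀ +
      (Z *ᵥ (η - θ₀).ofLp) ⬝ᵥ (Z *ᵥ (η - θ₀).ofLp) + lam * ‖η - θ₀‖ ^ 2 := by
    intro η
    obtain ⟨e, rfl⟩ : ∃ e, η = θ₀ + e := ⟨η - θ₀, by abel⟩
    have hc := congrArg (fun v => v ⬝ᵥ e.ofLp) hnormal
    simp only [add_dotProduct, smul_dotProduct, Matrix.mulVec_transpose,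
      ← Matrix.dotProduct_mulVec, smul_eq_mul] at hc
    have hz : (Z *ᵥ e.ofLp) ⬝ᵥ (Z *ᵥ θ₀.ofLp) = (Z *ᵥ θ₀.ofLp) ⬝ᵥ (Z *ᵥ e.ofLp) :=
      dotProduct_comm _ _
    have hx : (Z *ᵥ e.ofLp) ⬝ᵥ X = X ⬝ᵥ (Z *ᵥ e.ofLp) := dotProduct_comm _ _
    have hx' : (Z *ᵥ θ₀.ofLp) ⬝ᵥ X = X ⬝ᵥ (Z *ᵥ θ₀.ofLp) := dotProduct_comm _ _
    have he : e.ofLp ⬝ᵥ θ₀.ofLp = θ₀.ofLp ⬝ᵥ e.ofLp := dotProduct_comm _ _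
    simp only [ridgeObjective, hsq, hsq', add_sub_cancel_left, WithLp.ofLp_add,
      Matrix.mulVec_add, dotProduct_add, add_dotProduct, dotProduct_sub, sub_dotProduct,
      hz, hx, hx', he]
    linarith
  have hnn : ∀ v : κ → ℝ, 0 ≤ v ⬝ᵥ v := fun v =>
    Finset.sum_nonneg fun i _ => mul_self_nonneg (v i)
  constructor
  · intro h
    have h1 := h θ₀
    rw [key θ] at h1
    have h2 := hnn (Z *ᵥ (θ - θ₀).ofLp)
    have h3 : ‖θ - θ₀‖ ^ 2 ≤ 0 := by
      by_contra h4
      push Not at h4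
      have := mul_pos hlam h4
      linarith
    have h4 : ‖θ - θ₀‖ = 0 := by
      have := sq_nonneg ‖θ - θ₀‖
      exact pow_eq_zero_iff (two_ne_zero) |>.1 (le_antisymm h3 this)
    exact sub_eq_zero.1 (norm_eq_zero.1 h4)
  · rintro rfl η
    rw [key η]
    have h2 := hnn (Z *ᵥ (η - θ₀).ofLp)
    have := mul_nonneg hlam.le (sq_nonneg ‖η - θ₀‖)
    linarith

/-- The weighted norm `‖V^{1/2} v‖₂`, where `V^{1/2}` is the positive semidefinite square root
of the positive semidefinite matrix `V`. -/
noncomputable def weightedNorm {ι : Type*} [Fintype ι] [DecidableEq ι]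
    (V : Matrix ι ι ℝ) (v : EuclideanSpace ℝ ι) : ℝ :=
  ‖Matrix.toEuclideanCLM (𝕜 := ℝ) (CFC.sqrt V) v‖

/-- The confidence radius
`β(δ) = √r * √(2 * log (det(V)^{1/2} / (lam^{d/2} * δ))) + lam^{1/2} * s`,
where `d` is the size of the matrix `V`. -/
noncomputable def confidenceRadius {ι : Type*} [Fintype ι] [DecidableEq ι]
    (r s lam : ℝ) (V : Matrix ι ι ℝ) (δ : ℝ) : ℝ :=
  √r * √(2 * Real.log (√V.det / (lam ^ ((Fintype.card ι : ℝ) / 2) * δ))) + √lam * s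

/-! Method of mixtures. Fix a coordinate, divide its noise by `√r` so that the variance is at most
one, and let `S = Zᵀe` for the scaled noise `e`. Averaging the exponential martingales `exp(θ·S -
‖Zθ‖²/2)` over `θ ~ N(0, lam⁻¹ I)` gives, up to the factor `lam^(d/2)`, the quantity `exp(S·V⁻¹S/2)
/ √(det V)`. This average is never computed here. A rank-one update shows directly that each new row
multiplies the quantity by `mixtureFactor`, whose conditional mean is at most one
(`mixturePotential_update`, `lintegral_mul_mixtureFactor_le`). Its expectation therefore stays below
the initial value, and since `k` is fixed, Markov's inequality yields the tail bound
`measure_selfNormalized_gt_le`. The estimation error is `V⁻¹S`, scaled back by `√r`, minus the bias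
`lam V⁻¹θ`, whose weighted norm is at most `√lam ‖θ‖` because `V ⪰ lam I`. A union bound over the
`n` coordinates, each with level `δ/n`, finishes. -/

/-! ### One-step Gaussian integral -/

section GaussianKernel

/-- The factor by which the Gaussian mixture grows when a regressor with leverage `a` and
prediction `b` is observed together with the noise value `y`. -/
noncomputable def mixtureFactor (a b y : ℝ) : ℝ :=
  Real.exp ((-b ^ 2 + 2 * b * y + a * y ^ 2) / (2 * (1 + a))) / √(1 + a)

lemma mixtureFactor_nonneg (a b y : ℝ) : 0 ≤ mixtureFactor a b y := by
  unfold mixtureFactor; positivity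

lemma measurable_mixtureFactor :
    Measurable fun p : ℝ × ℝ × ℝ => mixtureFactor p.1 p.2.1 p.2.2 := by
  unfold mixtureFactor
  fun_prop

lemma measurable_mixtureFactor_right (a b : ℝ) : Measurable (mixtureFactor a b) := by
  unfold mixtureFactor
  fun_prop

/-- Completing the square: the factor times the `N(0, 1)` density is the `N(b, 1 + a)` density. -/
lemma lintegral_mixtureFactor_standard {a : ℝ} (ha : 0 ≤ a) (b : ℝ) :
    ∫⁻ y, ENNReal.ofReal (mixtureFactor a b y) ∂gaussianReal 0 1 = 1 := by
  have h1 : (0 : ℝ) < 1 + a := by positivity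
  have hv : (1 + a).toNNReal ≠ 0 := (Real.toNNReal_pos.2 h1).ne'
  rw [gaussianReal_of_var_ne_zero _ one_ne_zero,
    lintegral_withDensity_eq_lintegral_mul _ (measurable_gaussianPDF _ _)
      (measurable_mixtureFactor_right a b).ennreal_ofReal,
    ← lintegral_gaussianPDF_eq_one b hv]
  refine lintegral_congr fun y => ?_
  simp only [Pi.mul_apply, gaussianPDF]
  rw [← ENNReal.ofReal_mul (gaussianPDFReal_nonneg _ _ _)]
  congr 1
  simp only [gaussianPDFReal, mixtureFactor, NNReal.coe_one, Real.coe_toNNReal _ h1.le]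
  rw [Real.sqrt_mul (by positivity) (1 + a), div_eq_mul_inv (Real.exp _) √(1 + a),
    mul_inv, mul_one,
    show ∀ p q t w : ℝ, p * q * (t * w) = p * w * (q * t) by intros; ring, ← Real.exp_add]
  congr 2
  field_simp
  ring

/-- As `σ² ≤ 1`, the exponent at `σy` is at most the average of the exponents at `y` and `-y` with
weights `(1 ± σ)/2`, whose mean point is `σy`. Convexity of `exp` does the rest. -/
lemma mixtureFactor_mul_le {a : ℝ} (ha : 0 ≤ a) (b y : ℝ) {σ : ℝ} (h0 : 0 ≤ σ) (h1 : σ ≤ 1) :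
    mixtureFactor a b (σ * y) ≤
      (1 + σ) / 2 * mixtureFactor a b y + (1 - σ) / 2 * mixtureFactor a b (-y) := by
  have hc := convexOn_exp.2 (Set.mem_univ ((-b ^ 2 + 2 * b * y + a * y ^ 2) / (2 * (1 + a))))
    (Set.mem_univ ((-b ^ 2 + 2 * b * (-y) + a * (-y) ^ 2) / (2 * (1 + a))))
    (show 0 ≤ (1 + σ) / 2 by linarith) (show 0 ≤ (1 - σ) / 2 by linarith) (by ring)
  simp only [smul_eq_mul] at hc
  unfold mixtureFactor
  rw [← mul_div_assoc, ← mul_div_assoc, ← add_div]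
  gcongr
  refine le_trans (Real.exp_le_exp.2 ?_) hc
  rw [← mul_div_assoc, ← mul_div_assoc, ← add_div]
  refine div_le_div_of_nonneg_right ?_ (by positivity)
  have : a * (σ ^ 2 * y ^ 2) ≤ a * (1 * y ^ 2) := by
    gcongr
    exact pow_le_one₀ h0 h1
  linarith

/-- Writing the noise as `√v` times a standard Gaussian and using symmetry reduces to variance one.
This includes `v = 0`, where there is no density. -/
lemma lintegral_mixtureFactor_le_one {a : ℝ} (ha : 0 ≤ a) (b : ℝ) {v : NNReal} (hv : v ≤ 1) :
    ∫⁻ y, ENNReal.ofReal (mixtureFactor a b y) ∂gaussianReal 0 v ≤ 1 := by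
  have hσ1 : √(v : ℝ) ≤ 1 := Real.sqrt_le_one.2 (by exact_mod_cast hv)
  have hσ0 := Real.sqrt_nonneg (v : ℝ)
  have hmeas := (measurable_mixtureFactor_right a b).ennreal_ofReal
  have hmap : gaussianReal 0 v = (gaussianReal 0 1).map (√(v : ℝ) * ·) := by
    rw [gaussianReal_map_const_mul, mul_zero]
    congr 1
    ext
    simp
  have hmeas_neg : Measurable fun y => ENNReal.ofReal (mixtureFactor a b (-y)) :=
    hmeas.comp measurable_neg
  have hneg : ∫⁻ y, ENNReal.ofReal (mixtureFactor a b (-y)) ∂gaussianReal 0 1 = 1 := by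
    rw [← lintegral_mixtureFactor_standard ha b]
    conv_rhs => rw [← neg_zero, ← gaussianReal_map_neg, lintegral_map hmeas (by fun_prop)]
  rw [hmap, lintegral_map hmeas (by fun_prop)]
  calc ∫⁻ y, ENNReal.ofReal (mixtureFactor a b (√(v : ℝ) * y)) ∂gaussianReal 0 1
      ≤ ∫⁻ y, (ENNReal.ofReal ((1 + √(v : ℝ)) / 2) * ENNReal.ofReal (mixtureFactor a b y) +
          ENNReal.ofReal ((1 - √(v : ℝ)) / 2) * ENNReal.ofReal (mixtureFactor a b (-y)))
          ∂gaussianReal 0 1 := by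
        refine lintegral_mono fun y => ?_
        have hp : 0 ≤ (1 + √(v : ℝ)) / 2 := by linarith
        have hq : 0 ≤ (1 - √(v : ℝ)) / 2 := by linarith
        rw [← ENNReal.ofReal_mul hp, ← ENNReal.ofReal_mul hq,
          ← ENNReal.ofReal_add (mul_nonneg hp (mixtureFactor_nonneg _ _ _))
            (mul_nonneg hq (mixtureFactor_nonneg _ _ _))]
        exact ENNReal.ofReal_le_ofReal (mixtureFactor_mul_le ha b y hσ0 hσ1)
    _ = 1 := by
        rw [lintegral_add_left (hmeas.const_mul _), lintegral_const_mul _ hmeas,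
          lintegral_const_mul _ hmeas_neg, lintegral_mixtureFactor_standard ha,
          hneg, mul_one, mul_one, ← ENNReal.ofReal_add (by linarith) (by linarith)]
        ring_nf
        simp

end GaussianKernel

/-! ### Integrating out fresh noise -/

section Conditioning

variable {Ω E F : Type*} {m mΩ : MeasurableSpace Ω} [MeasurableSpace E] [MeasurableSpace F]

/-- Integrating out a variable that is independent of a sub-σ-algebra. -/
lemma lintegral_comp_of_indep {P : Measure Ω} [IsProbabilityMeasure P]
    (hm : m ≤ mΩ) {Y : Ω → E} {η : Ω → F} (hY : Measurable[m] Y) (hη : Measurable η)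
    (hind : Indep (MeasurableSpace.comap η inferInstance) m P)
    {g : E × F → ENNReal} (hg : Measurable g) :
    ∫⁻ ω, g (Y ω, η ω) ∂P = ∫⁻ ω, ∫⁻ e, g (Y ω, e) ∂(P.map η) ∂P := by
  have hY' : Measurable Y := hY.mono hm le_rfl
  have hYη : IndepFun Y η P := by
    rw [IndepFun_iff_Indep]
    exact indep_of_indep_of_le_left hind.symm hY.comap_le
  have hmap := (indepFun_iff_map_prod_eq_prod_map_map hY'.aemeasurable hη.aemeasurable).1 hYη
  have : IsProbabilityMeasure (P.map η) := Measure.isProbabilityMeasure_map hη.aemeasurable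
  rw [← lintegral_map (g := fun ω => (Y ω, η ω)) hg (hY'.prodMk hη), hmap,
    lintegral_prod _ hg.aemeasurable, lintegral_map hg.lintegral_prod_right' hY']

/-- A predictable weight times the mixture factor of fresh Gaussian noise does not increase in
expectation. -/
lemma lintegral_mul_mixtureFactor_le {P : Measure Ω} [IsProbabilityMeasure P]
    (hm : m ≤ mΩ) {c : Ω → ENNReal} {a b η : Ω → ℝ}
    (hc : Measurable[m] c) (ha : Measurable[m] a) (hb : Measurable[m] b) (ha0 : ∀ ω, 0 ≤ a ω)
    (hη : Measurable η) (hind : Indep (MeasurableSpace.comap η inferInstance) m P)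
    {v : NNReal} (hv : v ≤ 1) (hlaw : P.map η = gaussianReal 0 v) :
    ∫⁻ ω, c ω * ENNReal.ofReal (mixtureFactor (a ω) (b ω) (η ω)) ∂P ≤ ∫⁻ ω, c ω ∂P := by
  have hg : Measurable fun p : (ENNReal × ℝ × ℝ) × ℝ =>
      p.1.1 * ENNReal.ofReal (mixtureFactor p.1.2.1 p.1.2.2 p.2) := by
    have := measurable_mixtureFactor.comp (show Measurable fun p : (ENNReal × ℝ × ℝ) × ℝ =>
      (p.1.2.1, p.1.2.2, p.2) by fun_prop)
    exact (measurable_fst.comp measurable_fst).mul this.ennreal_ofReal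
  have h := lintegral_comp_of_indep hm (hc.prodMk (ha.prodMk hb)) hη hind hg
  simp only at h
  rw [h]
  refine lintegral_mono fun ω => ?_
  rw [lintegral_const_mul _ (measurable_mixtureFactor_right _ _).ennreal_ofReal, hlaw]
  exact (mul_le_mul_right (lintegral_mixtureFactor_le_one (ha0 ω) _ hv) _).trans_eq (mul_one _)

end Conditioning

/-! ### Rank-one updates of the potential -/

section RankOneUpdate

variable {ι : Type*} [Fintype ι]

lemma Matrix.PosDef.add_vecMulVec_self {V : Matrix ι ι ℝ} (hV : V.PosDef) (z : ι → ℝ) :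
    (V + vecMulVec z z).PosDef := by
  simpa using hV.add_posSemidef (Matrix.posSemidef_vecMulVec_self_star z)

variable [DecidableEq ι]

lemma Matrix.PosDef.inv_mulVec_dotProduct_comm {V : Matrix ι ι ℝ} (hV : V.PosDef)
    (y z : ι → ℝ) : y ⬝ᵥ (V⁻¹ *ᵥ z) = z ⬝ᵥ (V⁻¹ *ᵥ y) := by
  have hsymm : (V⁻¹)ᵀ = V⁻¹ := by
    simpa [Matrix.conjTranspose_eq_transpose_of_trivial] using hV.inv.isHermitian.eq
  rw [dotProduct_mulVec, ← mulVec_transpose, hsymm, dotProduct_comm]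

lemma Matrix.PosDef.mulVec_inv_mulVec {V : Matrix ι ι ℝ} (hV : V.PosDef) (y : ι → ℝ) :
    V *ᵥ (V⁻¹ *ᵥ y) = y := by
  rw [Matrix.mulVec_mulVec, Matrix.mul_nonsing_inv _ hV.det_pos.ne'.isUnit, Matrix.one_mulVec]

lemma Matrix.PosDef.inv_mulVec_mulVec {V : Matrix ι ι ℝ} (hV : V.PosDef) (y : ι → ℝ) :
    V⁻¹ *ᵥ (V *ᵥ y) = y := by
  rw [Matrix.mulVec_mulVec, Matrix.nonsing_inv_mul _ hV.det_pos.ne'.isUnit, Matrix.one_mulVec]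

lemma Matrix.PosDef.dotProduct_inv_mulVec_nonneg {V : Matrix ι ι ℝ} (hV : V.PosDef)
    (y : ι → ℝ) : 0 ≤ y ⬝ᵥ (V⁻¹ *ᵥ y) := by
  simpa using hV.inv.posSemidef.dotProduct_mulVec_nonneg y

lemma Matrix.PosDef.det_add_vecMulVec_self {V : Matrix ι ι ℝ} (hV : V.PosDef) (z : ι → ℝ) :
    (V + vecMulVec z z).det = V.det * (1 + z ⬝ᵥ (V⁻¹ *ᵥ z)) := by
  rw [vecMulVec_eq Unit, det_add_replicateCol_mul_replicateRow (ι := Unit) hV.det_pos.ne'.isUnit, det_unique (n := Unit),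
    Matrix.mul_assoc, ← replicateCol_mulVec, Matrix.add_apply, Matrix.one_apply_eq,
    replicateRow_mul_replicateCol_apply]

lemma Matrix.PosDef.dotProduct_inv_mulVec_add_vecMulVec_self {V : Matrix ι ι ℝ} (hV : V.PosDef)
    (z S : ι → ℝ) (y : ℝ) :
    (S + y • z) ⬝ᵥ ((V + vecMulVec z z)⁻¹ *ᵥ (S + y • z)) = S ⬝ᵥ (V⁻¹ *ᵥ S) +
      (-(z ⬝ᵥ (V⁻¹ *ᵥ S)) ^ 2 + 2 * (z ⬝ᵥ (V⁻¹ *ᵥ S)) * y + (z ⬝ᵥ (V⁻¹ *ᵥ z)) * y ^ 2) /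
        (1 + z ⬝ᵥ (V⁻¹ *ᵥ z)) := by
  have ha := hV.dotProduct_inv_mulVec_nonneg z
  have hb := hV.inv_mulVec_dotProduct_comm S z
  have hz := hV.mulVec_inv_mulVec z
  have hS := hV.mulVec_inv_mulVec S
  set p := V⁻¹ *ᵥ z
  set q := V⁻¹ *ᵥ S
  set a := z ⬝ᵥ p
  set b := z ⬝ᵥ q
  have h1 : 1 + a ≠ 0 := by positivity
  -- A Sherman–Morrison solution, verified by applying `V + zzᵀ` to it.
  have hsol : (V + vecMulVec z z)⁻¹ *ᵥ (S + y • z) = q + ((y - b) / (1 + a)) • p := by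
    rw [← (hV.add_vecMulVec_self z).inv_mulVec_mulVec (q + ((y - b) / (1 + a)) • p)]
    congr 1
    rw [Matrix.add_mulVec, Matrix.mulVec_add, Matrix.mulVec_smul, hz, hS, vecMulVec_mulVec]
    ext i
    simp only [dotProduct_add, dotProduct_smul, Pi.add_apply, Pi.smul_apply, smul_eq_mul,
      MulOpposite.smul_eq_mul_unop, MulOpposite.unop_op]
    change _ = S i + (y - b) / (1 + a) * z i + z i * (b + (y - b) / (1 + a) * a)
    field_simp
    ring
  rw [hsol]
  simp only [dotProduct_add, add_dotProduct, dotProduct_smul, smul_dotProduct, smul_eq_mul, hb]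
  change _ + y * b + (y - b) / (1 + a) * (b + y * a) = _
  field_simp
  ring

/-- The Gaussian mixture of the exponential martingales, up to normalization. -/
noncomputable def mixturePotential (V : Matrix ι ι ℝ) (S : ι → ℝ) : ℝ :=
  Real.exp (S ⬝ᵥ (V⁻¹ *ᵥ S) / 2) / √V.det

lemma mixturePotential_nonneg (V : Matrix ι ι ℝ) (S : ι → ℝ) : 0 ≤ mixturePotential V S := by
  unfold mixturePotential; positivity

/-- The quadratic form supplies the exponent of `mixtureFactor`, the determinant its `√(1 + a)`. -/
lemma mixturePotential_update {V : Matrix ι ι ℝ} (hV : V.PosDef) (z S : ι → ℝ) (y : ℝ) :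
    mixturePotential (V + vecMulVec z z) (S + y • z) =
      mixturePotential V S * mixtureFactor (z ⬝ᵥ (V⁻¹ *ᵥ z)) (z ⬝ᵥ (V⁻¹ *ᵥ S)) y := by
  have ha := hV.dotProduct_inv_mulVec_nonneg z
  rw [mixturePotential, hV.dotProduct_inv_mulVec_add_vecMulVec_self, hV.det_add_vecMulVec_self,
    Real.sqrt_mul hV.det_pos.le, add_div, Real.exp_add, mixturePotential, mixtureFactor, div_div,
    mul_comm (1 + _) (2 : ℝ), mul_div_mul_comm]

end RankOneUpdate

/-! ### Entrywise measurability of determinants and inverses -/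

section Measurability

variable {Ω ι : Type*} [MeasurableSpace Ω] [Fintype ι] [DecidableEq ι]

lemma measurable_det_of_apply {M : Ω → Matrix ι ι ℝ} (hM : ∀ i j, Measurable fun ω => M ω i j) :
    Measurable fun ω => (M ω).det := by
  simp only [det_apply]
  exact Finset.measurable_sum _ fun σ _ =>
    (Finset.measurable_prod _ fun i _ => hM (σ i) i).const_smul _

/-- Cramer's rule; singular matrices are harmless since their inverse is zero by convention. -/
lemma measurable_inv_apply {M : Ω → Matrix ι ι ℝ} (hM : ∀ i j, Measurable fun ω => M ω i j)
    (i j : ι) : Measurable fun ω => (M ω)⁻¹ i j := by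
  simp only [inv_def, Matrix.smul_apply, adjugate_apply, Ring.inverse_eq_inv', smul_eq_mul]
  refine (measurable_det_of_apply hM).inv.mul (measurable_det_of_apply fun k l => ?_)
  by_cases h : k = j
  · subst h
    simp
  · simpa [updateRow_ne h] using hM k l

lemma measurable_dotProduct_inv_mulVec {M : Ω → Matrix ι ι ℝ} {f g : Ω → ι → ℝ}
    (hM : ∀ i j, Measurable fun ω => M ω i j) (hf : ∀ i, Measurable fun ω => f ω i)
    (hg : ∀ i, Measurable fun ω => g ω i) :
    Measurable fun ω => f ω ⬝ᵥ ((M ω)⁻¹ *ᵥ g ω) := by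
  simp only [dotProduct, mulVec]
  exact Finset.measurable_sum _ fun i _ => (hf i).mul <|
    Finset.measurable_sum _ fun j _ => (measurable_inv_apply hM i j).mul (hg j)

lemma measurable_mixturePotential {M : Ω → Matrix ι ι ℝ} {f : Ω → ι → ℝ}
    (hM : ∀ i j, Measurable fun ω => M ω i j) (hf : ∀ i, Measurable fun ω => f ω i) :
    Measurable fun ω => mixturePotential (M ω) (f ω) :=
  ((measurable_dotProduct_inv_mulVec hM hf hf).div_const 2).exp.div
    (measurable_det_of_apply hM).sqrt

end Measurability

/-! ### Noise and bias in the ridge error -/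

section Deterministic

variable {ι κ : Type*} [Fintype ι] [DecidableEq ι] [Fintype κ]

lemma weightedNorm_add_le (V : Matrix ι ι ℝ) (v w : EuclideanSpace ℝ ι) :
    weightedNorm V (v + w) ≤ weightedNorm V v + weightedNorm V w := by
  simpa [weightedNorm] using norm_add_le _ _

lemma weightedNorm_smul (V : Matrix ι ι ℝ) (c : ℝ) (v : EuclideanSpace ℝ ι) :
    weightedNorm V (c • v) = |c| * weightedNorm V v := by
  simp [weightedNorm, norm_smul]

lemma weightedNorm_eq_sqrt {V : Matrix ι ι ℝ} (hV : V.PosSemidef) (v : EuclideanSpace ℝ ι) :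
    weightedNorm V v = √(v.ofLp ⬝ᵥ (V *ᵥ v.ofLp)) := by
  have hsa : IsSelfAdjoint (toEuclideanCLM (𝕜 := ℝ) (CFC.sqrt V)) :=
    (CFC.sqrt_nonneg V).isSelfAdjoint.map _
  rw [weightedNorm, ← Real.sqrt_sq (norm_nonneg _), ← real_inner_self_eq_norm_sq,
    ← ContinuousLinearMap.adjoint_inner_right, hsa.adjoint_eq, ← ContinuousLinearMap.comp_apply,
    ← ContinuousLinearMap.mul_def, ← map_mul, CFC.sqrt_mul_sqrt_self _ hV.nonneg,
    inner_toEuclideanCLM]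

lemma weightedNorm_inv_mulVec {V : Matrix ι ι ℝ} (hV : V.PosDef) (y : ι → ℝ) :
    weightedNorm V (WithLp.toLp 2 (V⁻¹ *ᵥ y)) = √(y ⬝ᵥ (V⁻¹ *ᵥ y)) := by
  rw [weightedNorm_eq_sqrt hV.posSemidef, hV.mulVec_inv_mulVec, dotProduct_comm]

lemma dotProduct_inv_regGram_mulVec_le {lam : ℝ} (hlam : 0 < lam) (Z : Matrix κ ι ℝ)
    (θ : EuclideanSpace ℝ ι) :
    θ.ofLp ⬝ᵥ ((regGram lam Z)⁻¹ *ᵥ θ.ofLp) ≤ ‖θ‖ ^ 2 / lam := by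
  have hV := regGram_posDef hlam Z
  set p := (regGram lam Z)⁻¹ *ᵥ θ.ofLp with hp
  have hsq : ‖θ‖ ^ 2 = θ.ofLp ⬝ᵥ θ.ofLp := by
    rw [EuclideanSpace.real_norm_sq_eq]
    simp [dotProduct, sq]
  -- This is `V ⪰ lam I` tested on `p = V⁻¹θ`; combined with `‖θ - lam p‖² ≥ 0` it gives the bound.
  have h1 : lam * (p ⬝ᵥ p) ≤ θ.ofLp ⬝ᵥ p := by
    have h2 : regGram lam Z *ᵥ p = θ.ofLp := hV.mulVec_inv_mulVec _
    conv_rhs => rw [← h2, dotProduct_comm, regGram, add_mulVec, smul_mulVec, one_mulVec,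
      dotProduct_add, dotProduct_smul, smul_eq_mul, ← mulVec_mulVec, dotProduct_transpose_mulVec]
    have : 0 ≤ (Z *ᵥ p) ⬝ᵥ (Z *ᵥ p) := Finset.sum_nonneg fun i _ => mul_self_nonneg _
    linarith
  have h3 : 0 ≤ (θ.ofLp - lam • p) ⬝ᵥ (θ.ofLp - lam • p) :=
    Finset.sum_nonneg fun i _ => mul_self_nonneg _
  have h4 := dotProduct_comm p θ.ofLp
  simp only [sub_dotProduct, dotProduct_sub, smul_dotProduct, dotProduct_smul, smul_eq_mul,
    h4] at h3
  rw [le_div_iff₀ hlam, hsq]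
  nlinarith

/-- The error of the ridge estimate splits into a self-normalized noise term and a bias term. -/
lemma weightedNorm_ridgeEstimate_sub_le {lam : ℝ} (hlam : 0 < lam) (Z : Matrix κ ι ℝ)
    (X e : κ → ℝ) (θ : EuclideanSpace ℝ ι) (hX : X = Z *ᵥ θ.ofLp + e) :
    weightedNorm (regGram lam Z) (ridgeEstimate lam Z X - θ) ≤
      √((Zᵀ *ᵥ e) ⬝ᵥ ((regGram lam Z)⁻¹ *ᵥ (Zᵀ *ᵥ e))) + √lam * ‖θ‖ := by
  have hV := regGram_posDef hlam Z
  have hsplit : ridgeEstimate lam Z X - θ =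
      WithLp.toLp 2 ((regGram lam Z)⁻¹ *ᵥ (Zᵀ *ᵥ e)) +
        (-lam) • WithLp.toLp 2 ((regGram lam Z)⁻¹ *ᵥ θ.ofLp) := by
    apply WithLp.ofLp_injective
    have h1 : Zᵀ *ᵥ X = regGram lam Z *ᵥ θ.ofLp + (Zᵀ *ᵥ e + (-lam) • θ.ofLp) := by
      rw [hX, mulVec_add, regGram, add_mulVec, smul_mulVec, one_mulVec, mulVec_mulVec, neg_smul]
      abel
    simp only [ridgeEstimate, WithLp.ofLp_sub, WithLp.ofLp_add, WithLp.ofLp_smul]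
    rw [h1, mulVec_add, hV.inv_mulVec_mulVec, mulVec_add, mulVec_smul]
    abel
  rw [hsplit]
  refine (weightedNorm_add_le _ _ _).trans ?_
  rw [weightedNorm_smul, weightedNorm_inv_mulVec hV, weightedNorm_inv_mulVec hV, abs_neg,
    abs_of_pos hlam]
  refine add_le_add_right ?_ _
  calc lam * √(θ.ofLp ⬝ᵥ ((regGram lam Z)⁻¹ *ᵥ θ.ofLp)) ≤ lam * √(‖θ‖ ^ 2 / lam) := by
        gcongr
        exact dotProduct_inv_regGram_mulVec_le hlam Z θ
    _ = √lam * ‖θ‖ := by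
        rw [Real.sqrt_div (by positivity), Real.sqrt_sq (norm_nonneg _)]
        nth_rw 1 [← Real.mul_self_sqrt hlam.le]
        have := Real.sqrt_pos.2 hlam
        field_simp

end Deterministic

/-! ### Self-normalized tail bound -/

section SelfNormalized

variable {ι : Type*} [DecidableEq ι]

lemma regGram_of_succ (lam : ℝ) (z : ℕ → ι → ℝ) (k : ℕ) :
    regGram lam (Matrix.of fun t : Fin (k + 1) => z t) =
      regGram lam (Matrix.of fun t : Fin k => z t) + vecMulVec (z k) (z k) := by
  ext i j
  simp only [regGram, Matrix.add_apply, Matrix.mul_apply, Fin.sum_univ_castSucc,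
    Matrix.transpose_apply, Matrix.of_apply, vecMulVec_apply, Fin.val_castSucc, Fin.val_last]
  ring

omit [DecidableEq ι] in
lemma transpose_of_succ_mulVec (z : ℕ → ι → ℝ) (e : ℕ → ℝ) (k : ℕ) :
    (Matrix.of fun t : Fin (k + 1) => z t)ᵀ *ᵥ (fun t : Fin (k + 1) => e t) =
      (Matrix.of fun t : Fin k => z t)ᵀ *ᵥ (fun t : Fin k => e t) + e k • z k := by
  ext i
  simp [mulVec, dotProduct, Fin.sum_univ_castSucc, mul_comm]

variable {Ω : Type*} {mΩ : MeasurableSpace Ω} {P : Measure Ω}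
  {ℱ : Filtration ℕ mΩ} {z : ℕ → Ω → ι → ℝ} {η : ℕ → Ω → ℝ}

lemma measurable_regGram_of_apply (hz : ∀ t i, Measurable[ℱ t] fun ω => z t ω i) (lam : ℝ)
    (k : ℕ) (i j : ι) :
    Measurable[ℱ k] fun ω => regGram lam (Matrix.of fun t : Fin k => z t ω) i j := by
  simp only [regGram, Matrix.add_apply, Matrix.mul_apply, Matrix.transpose_apply, Matrix.of_apply]
  refine Measurable.add_const (Finset.measurable_sum _ fun t _ => ?_) _
  exact ((hz t i).mono (ℱ.mono t.2.le) le_rfl).mul ((hz t j).mono (ℱ.mono t.2.le) le_rfl)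

omit [DecidableEq ι] in
lemma measurable_transpose_of_mulVec_apply (hz : ∀ t i, Measurable[ℱ t] fun ω => z t ω i)
    (hη : ∀ t, Measurable[ℱ (t + 1)] (η t)) (k : ℕ) (i : ι) :
    Measurable[ℱ k] fun ω =>
      ((Matrix.of fun t : Fin k => z t ω)ᵀ *ᵥ (fun t : Fin k => η t ω)) i := by
  simp only [mulVec, dotProduct, Matrix.transpose_apply, Matrix.of_apply]
  refine Finset.measurable_sum _ fun t _ => ?_
  -- Only `t < k` occurs, so the last noise term, known at time `t + 1`, is already known at time
  -- `k`.
  exact ((hz t i).mono (ℱ.mono t.2.le) le_rfl).mul ((hη t).mono (ℱ.mono t.2) le_rfl)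

variable [Fintype ι]

/-- The mixture potential of a regression with predictable regressors and Gaussian noise is a
supermartingale; in particular its expectation is at most its initial value. -/
lemma lintegral_mixturePotential_le [IsProbabilityMeasure P] {lam : ℝ} (hlam : 0 < lam)
    (hz : ∀ t i, Measurable[ℱ t] fun ω => z t ω i) (hη : ∀ t, Measurable[ℱ (t + 1)] (η t))
    (hind : ∀ t, Indep (MeasurableSpace.comap (η t) inferInstance) (ℱ t) P)
    {v : NNReal} (hv : v ≤ 1) (hlaw : ∀ t, P.map (η t) = gaussianReal 0 v) (k : ℕ) :
    ∫⁻ ω, ENNReal.ofReal (mixturePotential (regGram lam (Matrix.of fun t : Fin k => z t ω))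
        ((Matrix.of fun t : Fin k => z t ω)ᵀ *ᵥ (fun t : Fin k => η t ω))) ∂P ≤
      ENNReal.ofReal (1 / √(lam ^ Fintype.card ι)) := by
  induction k with
  | zero =>
    have h : ∀ Z : Matrix (Fin 0) ι ℝ, regGram lam Z = lam • (1 : Matrix ι ι ℝ) := fun Z => by
      ext i j
      simp [regGram]
    have h' : ∀ (Z : Matrix (Fin 0) ι ℝ) (e : Fin 0 → ℝ), Zᵀ *ᵥ e = 0 := fun Z e => by
      ext i
      simp [mulVec]
    simp only [h, h', mixturePotential, det_smul, det_one, mul_one, zero_dotProduct, zero_div,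
      Real.exp_zero, lintegral_const, measure_univ, le_refl]
  | succ k ih =>
    refine le_trans ?_ ih
    have hM := measurable_regGram_of_apply hz lam k
    have hS := measurable_transpose_of_mulVec_apply hz hη k
    -- The potential, leverage and prediction at step `k` are all `ℱ k`-measurable, while `η k` is
    -- independent of `ℱ k`.
    refine le_trans (le_of_eq (lintegral_congr fun ω => ?_))
      (lintegral_mul_mixtureFactor_le (ℱ.le k)
        (@measurable_mixturePotential _ _ (ℱ k) _ _ _ _ hM hS).ennreal_ofReal
        (@measurable_dotProduct_inv_mulVec _ _ (ℱ k) _ _ _ _ _ hM (hz k) (hz k))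
        (@measurable_dotProduct_inv_mulVec _ _ (ℱ k) _ _ _ _ _ hM (hz k) hS)
        (fun ω => (regGram_posDef hlam _).dotProduct_inv_mulVec_nonneg _)
        ((hη k).mono (ℱ.le _) le_rfl) (hind k) hv (hlaw k))
    rw [regGram_of_succ lam (fun t => z t ω), transpose_of_succ_mulVec (fun t => z t ω)
      (fun t => η t ω), mixturePotential_update (regGram_posDef hlam _),
      ENNReal.ofReal_mul (mixturePotential_nonneg _ _)]

/-- **Self-normalized tail bound** for predictable regressors and Gaussian noise of variance at
most one. -/
lemma measure_selfNormalized_gt_le [IsProbabilityMeasure P] {lam δ : ℝ} (hlam : 0 < lam)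
    (hδ : 0 < δ) (hz : ∀ t i, Measurable[ℱ t] fun ω => z t ω i)
    (hη : ∀ t, Measurable[ℱ (t + 1)] (η t))
    (hind : ∀ t, Indep (MeasurableSpace.comap (η t) inferInstance) (ℱ t) P)
    {v : NNReal} (hv : v ≤ 1) (hlaw : ∀ t, P.map (η t) = gaussianReal 0 v) (k : ℕ) :
    P {ω | 2 * Real.log (√(regGram lam (Matrix.of fun t : Fin k => z t ω)).det /
          (lam ^ ((Fintype.card ι : ℝ) / 2) * δ)) <
        ((Matrix.of fun t : Fin k => z t ω)ᵀ *ᵥ (fun t : Fin k => η t ω)) ⬝ᵥ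
          ((regGram lam (Matrix.of fun t : Fin k => z t ω))⁻¹ *ᵥ
            ((Matrix.of fun t : Fin k => z t ω)ᵀ *ᵥ (fun t : Fin k => η t ω)))} ≤
      ENNReal.ofReal δ := by
  have hpow : lam ^ ((Fintype.card ι : ℝ) / 2) = √(lam ^ Fintype.card ι) := by
    rw [Real.sqrt_eq_rpow, ← Real.rpow_natCast, ← Real.rpow_mul hlam.le]
    ring_nf
  rw [hpow]
  set c := √(lam ^ Fintype.card ι) with hc
  have hc0 : 0 < c := by positivity
  have hε0 : 0 < 1 / (c * δ) := by positivity
  set Ψ : Ω → ENNReal := fun ω => ENNReal.ofReal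
    (mixturePotential (regGram lam (Matrix.of fun t : Fin k => z t ω))
      ((Matrix.of fun t : Fin k => z t ω)ᵀ *ᵥ (fun t : Fin k => η t ω))) with hΨ
  have hΨm : Measurable Ψ := Measurable.ennreal_ofReal <| measurable_mixturePotential
    (fun i j => (measurable_regGram_of_apply hz lam k i j).mono (ℱ.le k) le_rfl)
    (fun i => (measurable_transpose_of_mulVec_apply hz hη k i).mono (ℱ.le k) le_rfl)
  -- Exponentiated, the event says that the potential exceeds `1 / (c * δ)`, whereas its mean is at
  -- most `1 / c`.
  calc _ ≤ P {ω | ENNReal.ofReal (1 / (c * δ)) ≤ Ψ ω} := by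
        refine measure_mono fun ω hω => ENNReal.ofReal_le_ofReal ?_
        have hdet := Real.sqrt_pos.2
          (regGram_posDef hlam (Matrix.of fun t : Fin k => z t ω)).det_pos
        rw [Set.mem_ofPred_eq, ← lt_div_iff₀' two_pos, Real.log_lt_iff_lt_exp (by positivity)] at hω
        rw [mixturePotential, le_div_iff₀ hdet, one_div_mul_eq_div]
        exact hω.le
    _ ≤ (∫⁻ ω, Ψ ω ∂P) / ENNReal.ofReal (1 / (c * δ)) :=
        meas_ge_le_lintegral_div hΨm.aemeasurable (ENNReal.ofReal_pos.2 hε0).ne'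
          ENNReal.ofReal_ne_top
    _ ≤ ENNReal.ofReal (1 / c) / ENNReal.ofReal (1 / (c * δ)) :=
        ENNReal.div_le_div_right (lintegral_mixturePotential_le hlam hz hη hind hv hlaw k) _
    _ = ENNReal.ofReal δ := by
        rw [← ENNReal.ofReal_div_of_pos hε0]
        congr 1
        field_simp

end SelfNormalized

/-! ### Union bound over the coordinates -/

lemma norm_row_le_frobNorm {p q : Type*} [Fintype p] [Fintype q] (M : Matrix p q ℝ) (i : p) :
    ‖(WithLp.toLp 2 (M i) : EuclideanSpace ℝ q)‖ ≤ frobNorm M := by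
  rw [EuclideanSpace.norm_eq, frobNorm, Matrix.frobenius_norm_def, ← Real.sqrt_eq_rpow]
  refine Real.sqrt_le_sqrt ?_
  have := Finset.single_le_sum (f := fun i => ∑ j, ‖M i j‖ ^ 2)
    (fun i _ => Finset.sum_nonneg fun j _ => by positivity) (Finset.mem_univ i)
  simpa using this

theorem theorem1 {n m : ℕ} {Ω : Type*} [MeasurableSpace Ω]
    (P : Measure Ω) [IsProbabilityMeasure P]
    (A : Matrix (Fin n) (Fin n) ℝ) (B : Matrix (Fin n) (Fin m) ℝ)
    (W : Matrix (Fin n) (Fin n) ℝ) (hW : W.PosSemidef)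
    (r s lam δ : ℝ) (hr : 0 < r) (hs : 0 < s) (hlam : 0 < lam) (hδ : 0 < δ) (hδ1 : δ ≤ 1)
    -- the known bounds `W ⪯ r I` and `‖[A B]‖_F ≤ s`
    (hWr : (r • (1 : Matrix (Fin n) (Fin n) ℝ) - W).PosSemidef)
    (hABs : frobNorm (Matrix.fromCols A B) ≤ s)
    -- `ℱ t` is the information available when the input `u[t]` is chosen
    (ℱ : Filtration ℕ ‹MeasurableSpace Ω›)
    (x : ℕ → Ω → EuclideanSpace ℝ (Fin n)) (u : ℕ → Ω → EuclideanSpace ℝ (Fin m))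
    (w : ℕ → Ω → EuclideanSpace ℝ (Fin n))
    (hx0 : Measurable[ℱ 0] (x 0)) (hu : ∀ t, Measurable[ℱ t] (u t))
    -- the noise is i.i.d. `N(0, W)`: `w[t]` has this law, is independent of the information at
    -- time `t`, which contains `w[0], …, w[t-1]`, and is known at time `t + 1`
    (hw : ∀ t, Measurable[ℱ (t + 1)] (w t))
    (hwlaw : ∀ t, P.map (w t) = multivariateGaussian 0 W)
    (hwindep : ∀ t, Indep (MeasurableSpace.comap (w t) inferInstance) (ℱ t) P)
    -- the dynamics `x[t+1] = A x[t] + B u[t] + w[t]`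
    (hdyn : ∀ t ω, x (t + 1) ω = Matrix.toLpLin 2 2 A (x t ω) + Matrix.toLpLin 2 2 B (u t ω) + w t ω)
    (k : ℕ) :
    P {ω | ∀ i : Fin n,
        weightedNorm (regGram lam (dataMatrix (x · ω) (u · ω) k))
            (ridgeEstimate lam (dataMatrix (x · ω) (u · ω) k) (responseVec (x · ω) k i)
              - trueParam A B i)
          ≤ confidenceRadius r s lam (regGram lam (dataMatrix (x · ω) (u · ω) k)) (δ / n)}
      ≥ ENNReal.ofReal (1 - δ) := by
  have hx : ∀ t, Measurable[ℱ t] (x t) := by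
    intro t
    induction t with
    | zero => exact hx0
    | succ t ih =>
      rw [show x (t + 1) = fun ω => Matrix.toLpLin 2 2 A (x t ω) + Matrix.toLpLin 2 2 B (u t ω) +
        w t ω from funext (hdyn t)]
      have hle := ℱ.mono t.le_succ
      refine Measurable.add (Measurable.add ?_ ?_) (hw t)
      · exact (LinearMap.continuous_of_finiteDimensional _).measurable.comp (ih.mono hle le_rfl)
      · exact (LinearMap.continuous_of_finiteDimensional _).measurable.comp
          ((hu t).mono hle le_rfl)
  set z : ℕ → Ω → Fin n ⊕ Fin m → ℝ := fun t ω =>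
    Sum.elim (fun i => x t ω i) (fun j => u t ω j) with hzdef
  have hz : ∀ t i, Measurable[ℱ t] fun ω => z t ω i := by
    rintro t (i | j)
    · exact (EuclideanSpace.proj (𝕜 := ℝ) i).continuous.measurable.comp (hx t)
    · exact (EuclideanSpace.proj (𝕜 := ℝ) j).continuous.measurable.comp (hu t)
  have hsr : 0 < √r := Real.sqrt_pos.2 hr
  set bad : Fin n → Set Ω := fun i =>
    {ω | 2 * Real.log (√(regGram lam (Matrix.of fun t : Fin k => z t ω)).det /
          (lam ^ ((Fintype.card (Fin n ⊕ Fin m) : ℝ) / 2) * (δ / n))) <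
        ((Matrix.of fun t : Fin k => z t ω)ᵀ *ᵥ (fun t : Fin k => w t ω i / √r)) ⬝ᵥ
          ((regGram lam (Matrix.of fun t : Fin k => z t ω))⁻¹ *ᵥ
            ((Matrix.of fun t : Fin k => z t ω)ᵀ *ᵥ (fun t : Fin k => w t ω i / √r)))} with hbad
  have hbad_le : ∀ i, P (bad i) ≤ ENNReal.ofReal (δ / n) := by
    intro i
    have hn : (0 : ℝ) < n := by exact_mod_cast i.pos
    have hproj : Measurable fun y : EuclideanSpace ℝ (Fin n) => y i / √r := by fun_prop
    have hWi : W i i ≤ r := by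
      have := hWr.diag_nonneg (i := i)
      simpa using this
    -- The scaled noise has variance `W i i / r`, at most one because `rI - W` has nonnegative
    -- diagonal.
    refine measure_selfNormalized_gt_le (η := fun t ω => w t ω i / √r)
      (v := (W i i / r).toNNReal) hlam (by positivity) hz (fun t => hproj.comp (hw t)) ?_ ?_ ?_ k
    · intro t
      refine indep_of_indep_of_le_left (hwindep t) ?_
      exact (hproj.comp (comap_measurable (w t))).comap_le
    · rw [Real.toNNReal_le_one, div_le_one hr]
      exact hWi
    · intro t
      have hwm : Measurable (w t) := (hw t).mono (ℱ.le _) le_rfl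
      rw [show (fun ω => w t ω i / √r) = (· / √r) ∘ (fun y : EuclideanSpace ℝ (Fin n) => y i) ∘ w t
        from rfl, ← Measure.map_map (by fun_prop) (by fun_prop),
        ← Measure.map_map (by fun_prop) hwm, hwlaw,
        (measurePreserving_eval_multivariateGaussian hW).map_eq, gaussianReal_map_div_const]
      congr 1
      · simp
      · ext
        simp [Real.sq_sqrt hr.le, hW.diag_nonneg, hr.le, div_nonneg]
  have hsub : {ω | ∀ i : Fin n,
        weightedNorm (regGram lam (dataMatrix (x · ω) (u · ω) k))
            (ridgeEstimate lam (dataMatrix (x · ω) (u · ω) k) (responseVec (x · ω) k i)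
              - trueParam A B i)
          ≤ confidenceRadius r s lam (regGram lam (dataMatrix (x · ω) (u · ω) k)) (δ / n)}ᶜ ⊆
      ⋃ i, bad i := by
    intro ω hω
    rw [Set.mem_compl_iff, Set.mem_ofPred_eq, not_forall] at hω
    obtain ⟨i, hi⟩ := hω
    refine Set.mem_iUnion.2 ⟨i, ?_⟩
    by_contra hgood
    apply hi
    rw [hbad, Set.mem_ofPred_eq, not_lt] at hgood
    have hresp : responseVec (x · ω) k i = dataMatrix (x · ω) (u · ω) k *ᵥ (trueParam A B i).ofLp +
        √r • fun t : Fin k => w t ω i / √r := by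
      ext t
      simp only [responseVec, hdyn, trueParam, Pi.add_apply, Pi.smul_apply, smul_eq_mul,
        mul_div_cancel₀ _ hsr.ne', PiLp.add_apply]
      simp [dataMatrix, mulVec, dotProduct, Matrix.toLpLin_apply, mul_comm]
    refine (weightedNorm_ridgeEstimate_sub_le hlam _ _ _ _ hresp).trans ?_
    refine add_le_add ?_ ?_
    · rw [mulVec_smul, mulVec_smul, dotProduct_smul, smul_dotProduct, smul_smul, smul_eq_mul,
        Real.mul_self_sqrt hr.le, Real.sqrt_mul hr.le]
      exact mul_le_mul_of_nonneg_left (Real.sqrt_le_sqrt hgood) (Real.sqrt_nonneg _)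
    · exact mul_le_mul_of_nonneg_left ((norm_row_le_frobNorm _ i).trans hABs) (Real.sqrt_nonneg _)
  have hcompl : P (⋃ i, bad i) ≤ ENNReal.ofReal δ := by
    refine (measure_iUnion_fintype_le P bad).trans ((Finset.sum_le_sum fun i _ => hbad_le i).trans ?_)
    -- For `n = 0` the level `δ / n` is `0` by convention, but the union is empty.
    rcases Nat.eq_zero_or_pos n with rfl | hn
    · simp
    · have : (0 : ℝ) < n := by exact_mod_cast hn
      rw [Finset.sum_const, Finset.card_univ, Fintype.card_fin, nsmul_eq_mul,
        ← ENNReal.ofReal_natCast, ← ENNReal.ofReal_mul this.le, mul_div_cancel₀ _ this.ne']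
  rw [ge_iff_le, ENNReal.ofReal_sub _ hδ.le, ENNReal.ofReal_one, tsub_le_iff_right,
    ← measure_univ (μ := P)]
  -- Subadditivity suffices, so the confidence event need not be shown measurable.
  exact (measure_univ_le_add_compl _).trans
    (add_le_add_right ((measure_mono hsub).trans hcompl) _)
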